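/- Let $\mathcal M=\{M_n\}_{n\ge 0}$ be a quasianalytic sequence, that is, a sequence of positive real numbers with $M_0=1$, $M_n^2\le M_{n-1}M_{n+1}$ for all $n\ge 1$ (log-convexity), and $\sum_{n=1}^\infty M_{n-1}/M_n=\infty$. For a closed cube $Q\subset\mathbb R^d$ with sides parallel to the coordinate axes, let $C_{\mathcal M}(Q)$ be the class of smooth functions $f:Q\to\mathbb R$ such that $\|D^\alpha f\|_{L^\infty(Q)}\le M_{|\alpha|}$ for every multi-index $\alpha$. Write $m_d$ for Lebesgue measure on $\mathbb R^d$, and let all $L^\infty$ norms be essential suprema with respect to $m_d$. For every integer $d\ge 1$ and all $t,s\in(0,1]$ there is a finite constant $\Theta$ such that $$\|f\|_{L^\infty(Q)}\le \Theta\,\|f\|_{L^\infty(E)}$$ for every such cube $Q\subset\mathbb R^d$ of sidelength $1$, every $f\in C_{\mathcal M}(Q)$ with $\|f\|_{L^\infty(Q)}\ge t$, and every Borel set $E\subset Q$ with $m_d(E)\ge s$. There is a least such constant; denote it by $\Theta_{\mathcal M}(d,t,s)$. Moreover, for every $d\ge 2$ and all $t,s\in(0,1]$, one has $\Theta_{\mathcal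 M}(1,t,\tfrac s2)\ge 1$ (so that the right-hand side below is defined) and $$\Theta_{\mathcal M}(d,t,s)\le \Theta_{\mathcal M}\Bigl(1,t,\frac s2\Bigr)\,\Theta_{\mathcal M}\Bigl(d-1,\frac{t}{\Theta_{\mathcal M}(1,t,\frac s2)},\frac s2\Bigr).$$ -/

import Mathlib

open MeasureTheory
open scoped NNReal

/-- A quasianalytic sequence: a logarithmically convex sequence `M` of positive reals, normalized by
`M 0 = 1`, with `∑_{n ≥ 1} M (n - 1) / M n = ∞`. The terms of the series are positive, so divergence
to infinity is the same as the failure of summability. -/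
structure IsQuasianalyticSeq (M : ℕ → ℝ) : Prop where
  pos : ∀ n, 0 < M n
  zero : M 0 = 1
  logConvex : ∀ n, M (n + 1) ^ 2 ≤ M n * M (n + 2)
  diverges : ¬ Summable fun n : ℕ => M n / M (n + 1)

/-- The closed cube in `ℝ^d` of sidelength `1`, with sides parallel to the coordinate axes, whose
corner with the smallest coordinates is `a`. -/
def unitCube {d : ℕ} (a : Fin d → ℝ) : Set (Fin d → ℝ) :=
  Set.Icc a (fun i => a i + 1)

/-- The class `C_M(Q)`: the smooth real functions on `Q` with `|D^α f| ≤ M n` on `Q` for all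
multi-indices `α` of order `n`. Only the values of `f` on `Q` matter.

A multi-index of order `n` is given by a word `j : Fin n → Fin d` that lists the directions in which
`f` is differentiated (`α k` is the number of `i` with `j i = k`), so that the value of the `n`-th
derivative below at the basis vectors `e_{j 0}, …, e_{j (n - 1)}` is `D^α f x`.
For `Q` a cube these derivatives are continuous on `Q`, so that their supremum over `Q` is their
`L^∞(Q)` norm. -/
def MemCarlemanClass (M : ℕ → ℝ) {d : ℕ} (Q : Set (Fin d → ℝ)) (f : (Fin d → ℝ) → ℝ) : Prop :=
  ContDiffOn ℝ ((⊤ : ℕ∞) : WithTop ℕ∞) f Q ∧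
    ∀ (n : ℕ) (j : Fin n → Fin d), ∀ x ∈ Q,
      |iteratedFDerivWithin ℝ n f Q x (fun i => Pi.single (j i) (1 : ℝ))| ≤ M n

/-- `C` is an admissible constant in the Remez-type inequality for `(M, d, t, s)`: one has
`‖f‖_{L^∞(Q)} ≤ C ‖f‖_{L^∞(E)}` for every cube `Q` of sidelength `1` in `ℝ^d`, every `f` in `C_M(Q)`
with `‖f‖_{L^∞(Q)} ≥ t`, and every Borel set `E ⊆ Q` of Lebesgue measure at least `s`.
All the norms are essential suprema with respect to Lebesgue measure. -/
def IsRemezConstant (M : ℕ → ℝ) (d : ℕ) (t s : ℝ) (C : ℝ≥0) : Prop :=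
  ∀ (a : Fin d → ℝ) (f : (Fin d → ℝ) → ℝ) (E : Set (Fin d → ℝ)),
    MemCarlemanClass M (unitCube a) f →
    ENNReal.ofReal t ≤ eLpNorm f ⊤ (volume.restrict (unitCube a)) →
    MeasurableSet E → E ⊆ unitCube a →
    ENNReal.ofReal s ≤ volume E →
    eLpNorm f ⊤ (volume.restrict (unitCube a)) ≤
      (C : ENNReal) * eLpNorm f ⊤ (volume.restrict E)

/-! In dimension one this is Bang's quantitative form of quasianalyticity. If |f| ≤ ε on a set of
measure s, repeated mean values over many separated points make finitely many derivatives small at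
one point. Smallness spreads from there, losing a factor 2 per step of length M n / (4 M (n + 1));
as these lengths have divergent sum, finitely many steps cover the unit interval
(`IsDerivChain.propagate`, `exists_smallness_threshold`). So sup |f| ≥ t excludes a too small bound
on E, and 1 / ε is admissible.

In higher dimension, Fubini gives a set A of measure greater than s / 2 of first coordinates whose
slices of E have measure at least s / 2. From a point where |f| ≥ t, the one-dimensional inequality
leads along the first axis to a slice over A, at the cost of a factor Θ 1; there |f| is still at
least t / Θ 1, and the inequality in dimension d - 1 applies (`IsRemezConstant.succ`). The strict
bound on the measure of A makes the loss exactly Θ 1. -/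

/-! ### Bang's propagation of smallness -/

/-- A sequence of functions on `[a, b]`, each the derivative of the preceding one, such that the
`n`-th function is bounded by `M n`. -/
structure IsDerivChain (M : ℕ → ℝ) (F : ℕ → ℝ → ℝ) (a b : ℝ) : Prop where
  hasDerivWithinAt : ∀ n, ∀ x ∈ Set.Icc a b, HasDerivWithinAt (F n) (F (n + 1) x) (Set.Icc a b) x
  bound : ∀ n, ∀ x ∈ Set.Icc a b, |F n x| ≤ M n

theorem IsQuasianalyticSeq.ratio_antitone {M : ℕ → ℝ} (hM : IsQuasianalyticSeq M) :
    Antitone fun n => M n / M (n + 1) := by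
  refine antitone_nat_of_succ_le fun n => ?_
  rw [div_le_div_iff₀ (hM.pos _) (hM.pos _)]
  nlinarith [hM.logConvex n]

/-- One step of Bang's argument: the smallness of all the derivatives is propagated at the cost of
one factor `2` over the distance `M N / (4 * M (N + 1))`. -/
theorem IsDerivChain.propagate_step {M : ℕ → ℝ} (hM : IsQuasianalyticSeq M) {F : ℕ → ℝ → ℝ}
    {a b : ℝ} (hF : IsDerivChain M F a b) {N : ℕ} {x : ℝ} (hx : x ∈ Set.Icc a b)
    (h : ∀ j, 2 ^ (N + 1) * |F j x| ≤ 2 ^ j * M j) {y : ℝ} (hy : y ∈ Set.Icc a b)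
    (hxy : |y - x| ≤ M N / M (N + 1) / 4) (j : ℕ) : 2 ^ N * |F j y| ≤ 2 ^ j * M j := by
  -- Downward induction on the order j: order N is the a priori bound, and order j + 1 controls the
  -- variation of order j. The ratios decrease, so the radius for N serves every j ≤ N.
  have key : ∀ m j, j + m = N → ∀ z ∈ Set.Icc a b, |z - x| ≤ M N / M (N + 1) / 4 →
      2 ^ N * |F j z| ≤ 2 ^ j * M j := by
    intro m
    induction m with
    | zero =>
      rintro j rfl z hz -
      exact mul_le_mul_of_nonneg_left (hF.bound _ z hz) (by positivity)
    | succ m ih =>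
      intro j hj z hz hzx
      have hsub : Set.uIcc x z ⊆ Set.Icc a b := Set.uIcc_subset_Icc hx hz
      have hb : ∀ w ∈ Set.uIcc x z, ‖F (j + 1) w‖ ≤ 2 ^ (j + 1) * M (j + 1) / 2 ^ N := by
        intro w hw
        rw [le_div_iff₀ (by positivity), mul_comm, Real.norm_eq_abs]
        exact ih (j + 1) (by omega) w (hsub hw)
          ((Set.abs_sub_left_of_mem_uIcc hw).trans hzx)
      have hmv := (convex_uIcc x z).norm_image_sub_le_of_norm_hasDerivWithin_le
        (fun w hw => (hF.hasDerivWithinAt j w (hsub hw)).mono hsub) hb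
        Set.left_mem_uIcc Set.right_mem_uIcc
      rw [Real.norm_eq_abs, Real.norm_eq_abs] at hmv
      have hr : M N / M (N + 1) ≤ M j / M (j + 1) := hM.ratio_antitone (by omega)
      have hM1 := hM.pos (j + 1)
      have hd : M (j + 1) * |z - x| ≤ M j / 4 := by
        have : |z - x| ≤ M j / M (j + 1) / 4 := hzx.trans (by linarith)
        calc M (j + 1) * |z - x| ≤ M (j + 1) * (M j / M (j + 1) / 4) := by gcongr
          _ = M j / 4 := by field_simp
      have h2 : 2 ^ N * |F j z - F j x| ≤ 2 ^ j * M j / 2 := by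
        calc 2 ^ N * |F j z - F j x|
            ≤ 2 ^ N * (2 ^ (j + 1) * M (j + 1) / 2 ^ N * |z - x|) := by gcongr
          _ = 2 ^ (j + 1) * (M (j + 1) * |z - x|) := by field_simp
          _ ≤ 2 ^ (j + 1) * (M j / 4) := by gcongr
          _ = 2 ^ j * M j / 2 := by ring
      have h3 : 2 ^ N * |F j z| ≤ 2 ^ N * |F j x| + 2 ^ N * |F j z - F j x| := by
        rw [← mul_add]
        gcongr
        linarith [abs_sub_abs_le_abs_sub (F j z) (F j x)]
      have h4 := h j
      rw [pow_succ] at h4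
      linarith
  rcases le_total j N with hj | hj
  · exact key (N - j) j (by omega) y hy hxy
  · exact mul_le_mul (pow_le_pow_right₀ one_le_two hj) (hF.bound _ y hy) (abs_nonneg _)
      (by positivity)

/-- The steps use the ratios of orders k + m - 1 down to k. By divergence their sum is as large as
desired for fixed k. -/
theorem IsDerivChain.propagate {M : ℕ → ℝ} (hM : IsQuasianalyticSeq M) {F : ℕ → ℝ → ℝ}
    {a b : ℝ} (hF : IsDerivChain M F a b) (k m : ℕ) {x : ℝ} (hx : x ∈ Set.Icc a b)
    (h : ∀ j, 2 ^ (k + m) * |F j x| ≤ 2 ^ j * M j) {y : ℝ} (hy : y ∈ Set.Icc a b)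
    (hxy : |y - x| ≤ ∑ i ∈ Finset.range m, M (k + i) / M (k + i + 1) / 4) (j : ℕ) :
    2 ^ k * |F j y| ≤ 2 ^ j * M j := by
  induction m generalizing x with
  | zero =>
    have : y = x := by simpa [sub_eq_zero] using hxy
    simpa [this] using h j
  | succ m ih =>
    rw [Finset.sum_range_succ] at hxy
    set S := ∑ i ∈ Finset.range m, M (k + i) / M (k + i + 1) / 4
    set r := M (k + m) / M (k + m + 1) / 4
    have hr : 0 < r := by have := hM.pos (k + m); have := hM.pos (k + m + 1); positivity
    have hS : 0 ≤ S := Finset.sum_nonneg fun i _ => by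
      have := hM.pos (k + i); have := hM.pos (k + i + 1); positivity
    -- z divides the way from x to y in the ratio r : S.
    obtain ⟨z, hz, h1, h2⟩ : ∃ z ∈ Set.uIcc x y, |z - x| ≤ r ∧ |y - z| ≤ S := by
      have hrS : 0 < r + S := by positivity
      have hc0 : 0 ≤ r / (r + S) := by positivity
      have hc1 : r / (r + S) ≤ 1 := (div_le_one hrS).2 (by linarith)
      refine ⟨x + r / (r + S) * (y - x), ?_, ?_, ?_⟩
      · rw [← segment_eq_uIcc]
        exact ⟨1 - r / (r + S), r / (r + S), by linarith, hc0, by ring,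
          by simp only [smul_eq_mul]; ring⟩
      · rw [add_sub_cancel_left, abs_mul, abs_of_nonneg hc0, div_mul_eq_mul_div,
          div_le_iff₀ hrS]
        gcongr
        linarith
      · have : y - (x + r / (r + S) * (y - x)) = S / (r + S) * (y - x) := by field_simp; ring
        rw [this, abs_mul, abs_of_nonneg (by positivity), div_mul_eq_mul_div, div_le_iff₀ hrS]
        gcongr
        linarith
    have hz' := Set.uIcc_subset_Icc hx hy hz
    exact ih hz' (hF.propagate_step hM hx h hz' h1) h2

/-! ### From a small set of values to a small function -/

/-- Repeated use of the mean value theorem: a function which is small at `2 ^ n` separated points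
has an `n`-th derivative which is small at some intermediate point. -/
theorem exists_small_deriv_of_separated {M : ℕ → ℝ} {F : ℕ → ℝ → ℝ} {a b : ℝ}
    (hF : IsDerivChain M F a b) {g : ℝ} (hg : 0 < g) (n : ℕ) (k : ℕ) (ε : ℝ) (u v : ℝ)
    (huv : Set.Icc u v ⊆ Set.Icc a b) (x : ℕ → ℝ) (hx : ∀ i < 2 ^ n, x i ∈ Set.Icc u v)
    (hε : ∀ i < 2 ^ n, |F k (x i)| ≤ ε) (hsep : ∀ i, i + 1 < 2 ^ n → x i + g ≤ x (i + 1)) :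
    ∃ ξ ∈ Set.Icc u v, |F (k + n) ξ| ≤ (2 / g) ^ n * ε := by
  induction n generalizing k ε x with
  | zero => exact ⟨x 0, hx 0 (by simp), by simpa using hε 0 (by simp)⟩
  | succ n ih =>
    -- The points are paired, which halves their number. The condition on i is inside the
    -- existential so that `choose` yields a total sequence.
    have hmv : ∀ i, ∃ ξ, i < 2 ^ n → ξ ∈ Set.Ioo (x (2 * i)) (x (2 * i + 1)) ∧
        F (k + 1) ξ = (F k (x (2 * i + 1)) - F k (x (2 * i))) / (x (2 * i + 1) - x (2 * i)) := by
      intro i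
      by_cases hi : i < 2 ^ n
      · have h1 : 2 * i + 1 < 2 ^ (n + 1) := by rw [pow_succ]; omega
        have hlt : x (2 * i) < x (2 * i + 1) := by linarith [hsep _ h1]
        have hsub : Set.Icc (x (2 * i)) (x (2 * i + 1)) ⊆ Set.Icc a b :=
          (Set.Icc_subset_Icc (hx _ (by omega)).1 (hx _ h1).2).trans huv
        obtain ⟨ξ, hξ, h⟩ := exists_hasDerivAt_eq_slope (F k) (F (k + 1)) hlt
          (fun w hw => ((hF.hasDerivWithinAt k w (hsub hw)).mono hsub).continuousWithinAt)
          (fun w hw => ((hF.hasDerivWithinAt k w (hsub ⟨hw.1.le, hw.2.le⟩)).mono hsub).hasDerivAt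
            (Icc_mem_nhds hw.1 hw.2))
        exact ⟨ξ, fun _ => ⟨hξ, h⟩⟩
      · exact ⟨0, fun h => absurd h hi⟩
    choose ξ hξ using hmv
    have hlt : ∀ i < 2 ^ n, 2 * i + 1 < 2 ^ (n + 1) := fun i hi => by rw [pow_succ]; omega
    have hmem : ∀ i < 2 ^ n, ξ i ∈ Set.Icc u v := fun i hi =>
      ⟨(hx _ (by have := hlt i hi; omega)).1.trans (hξ i hi).1.1.le,
        (hξ i hi).1.2.le.trans (hx _ (hlt i hi)).2⟩
    have hsmall : ∀ i < 2 ^ n, |F (k + 1) (ξ i)| ≤ 2 / g * ε := by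
      intro i hi
      have h1 := hlt i hi
      have hgap := hsep _ h1
      have hε0 : 0 ≤ ε := (abs_nonneg _).trans (hε _ h1)
      rw [(hξ i hi).2, abs_div, abs_of_pos (a := x (2 * i + 1) - x (2 * i)) (by linarith),
        div_le_iff₀ (by linarith)]
      calc |F k (x (2 * i + 1)) - F k (x (2 * i))| ≤ ε + ε :=
            (abs_sub _ _).trans (add_le_add (hε _ h1) (hε _ (by omega)))
        _ = 2 / g * ε * g := by field_simp; ring
        _ ≤ 2 / g * ε * (x (2 * i + 1) - x (2 * i)) := by gcongr; linarith
    -- The unused gap between consecutive pairs preserves the separation g.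
    have hgaps : ∀ i, i + 1 < 2 ^ n → ξ i + g ≤ ξ (i + 1) := by
      intro i hi
      have h2 := (hξ i (by omega)).1.2
      have h3 := (hξ (i + 1) hi).1.1
      have h4 := hsep (2 * i + 1) (by have := hlt _ hi; omega)
      rw [show 2 * (i + 1) = 2 * i + 1 + 1 by ring] at h3
      linarith
    obtain ⟨η, hη, h⟩ := ih (k + 1) (2 / g * ε) ξ hmem hsmall hgaps
    refine ⟨η, hη, ?_⟩
    rw [show k + (n + 1) = k + 1 + n by ring, pow_succ, mul_assoc]
    exact h

/-- A bounded set of positive measure contains many separated points. -/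
theorem exists_separated_points {E : Set ℝ} (hb : BddBelow E) {g : ℝ} (hg : 0 < g) (m : ℕ)
    (hE : ENNReal.ofReal (m * (2 * g)) < volume E) :
    ∃ x : ℕ → ℝ, (∀ i ≤ m, x i ∈ E) ∧ ∀ i < m, x i + g ≤ x (i + 1) := by
  induction m generalizing E with
  | zero =>
    obtain ⟨y, hy⟩ : E.Nonempty := nonempty_of_measure_ne_zero (ne_of_gt (by simpa using hE))
    exact ⟨fun _ => y, fun _ _ => hy, by simp⟩
  | succ m ih =>
    have hne : E.Nonempty := nonempty_of_measure_ne_zero (ne_of_gt (bot_le.trans_lt hE))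
    -- y is within g of the infimum and the remaining points lie beyond inf E + 2g: a gap g costs
    -- measure 2g.
    obtain ⟨y, hy, hyg⟩ := Real.lt_sInf_add_pos hne hg
    have hE' : ENNReal.ofReal (m * (2 * g)) <
        volume (E \ Set.Icc (sInf E) (sInf E + 2 * g)) := by
      refine lt_of_lt_of_le ?_ le_measure_sdiff
      rw [Real.volume_Icc, add_sub_cancel_left, lt_tsub_iff_right,
        ← ENNReal.ofReal_add (by positivity) (by positivity)]
      convert hE using 2
      push_cast
      ring
    obtain ⟨x, hx, hs⟩ := ih (hb.mono Set.sdiff_subset) hE'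
    refine ⟨fun i => Nat.casesOn i y x, ?_, ?_⟩
    · rintro (_ | i) hi
      · exact hy
      · exact (hx i (by omega)).1
    · rintro (_ | i) hi
      · obtain ⟨h1, h2⟩ := hx 0 (by omega)
        have h3 := csInf_le hb h1
        have h4 : sInf E + 2 * g < x 0 := by
          by_contra! h
          exact h2 ⟨h3, h⟩
        change y + g ≤ x 0
        linarith
      · exact hs i (by omega)

/-- For a quasianalytic class on an interval of length one, a function which is very small on a set
of measure at least `s` is small everywhere. -/
theorem exists_smallness_threshold {M : ℕ → ℝ} (hM : IsQuasianalyticSeq M) {t s : ℝ} (ht : 0 < t)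
    (hs : 0 < s) : ∃ ε > 0, ∀ (a : ℝ) (F : ℕ → ℝ → ℝ), IsDerivChain M F a (a + 1) →
      ∀ E ⊆ Set.Icc a (a + 1), ENNReal.ofReal s ≤ volume E → (∀ x ∈ E, |F 0 x| ≤ ε) →
      ∀ x ∈ Set.Icc a (a + 1), |F 0 x| < t := by
  -- Propagation will end with 2 ^ k * |F 0 y| ≤ 1; the m steps chosen next cover the unit interval.
  obtain ⟨k, hk⟩ := exists_pow_lt_of_lt_one ht (by norm_num : (1 / 2 : ℝ) < 1)
  obtain ⟨m, hm⟩ : ∃ m, 1 ≤ ∑ i ∈ Finset.range m, M (k + i) / M (k + i + 1) / 4 := by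
    by_contra! hcon
    refine hM.diverges ((summable_nat_add_iff k).1 ?_)
    refine summable_of_sum_range_le (c := 4)
      (fun n => (div_pos (hM.pos _) (hM.pos _)).le) fun n => ?_
    have := hcon n
    rw [← Finset.sum_div] at this
    simp only [add_comm k] at this
    linarith
  set N := k + m
  -- Among K groups of 2 ^ N gaps, one has length at most 1 / K. There F j varies by at most half of
  -- the target M j / 2 ^ N; ε will account for the other half.
  obtain ⟨K, hK0, hK⟩ : ∃ K : ℕ, 0 < K ∧ ∀ j ∈ Finset.range N,
      M (j + 1) * (1 / (K : ℝ)) ≤ M j / 2 ^ (N + 1) := by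
    refine ((Filter.eventually_gt_atTop 0).and
      ((Filter.eventually_all_finset _).2 fun j _ => ?_)).exists
    have hl : Filter.Tendsto (fun K : ℕ => M (j + 1) * (1 / (K : ℝ))) Filter.atTop (nhds 0) := by
      simpa using tendsto_one_div_atTop_nhds_zero_nat.const_mul (M (j + 1))
    exact (hl.eventually_lt_const (div_pos (hM.pos j) (by positivity))).mono fun _ h => h.le
  have hKr : (0 : ℝ) < K := by exact_mod_cast hK0
  set m' := K * 2 ^ N
  set g := s / (4 * (m' + 1))
  have hg : 0 < g := by positivity
  obtain ⟨ε, hε0, hε⟩ : ∃ ε : ℝ, 0 < ε ∧ ∀ j ∈ Finset.range N,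
      (2 / g) ^ j * ε ≤ M j / 2 ^ (N + 1) := by
    have h0 : ∀ᶠ ε : ℝ in nhdsWithin 0 (Set.Ioi 0), 0 < ε := self_mem_nhdsWithin
    refine (h0.and ((Filter.eventually_all_finset _).2 fun j _ => ?_)).exists
    have hl : Filter.Tendsto (fun ε : ℝ => (2 / g) ^ j * ε) (nhdsWithin 0 (Set.Ioi 0))
        (nhds 0) := by
      have : Continuous fun ε : ℝ => (2 / g) ^ j * ε := by fun_prop
      simpa using (this.tendsto 0).mono_left nhdsWithin_le_nhds
    exact (hl.eventually_lt_const (div_pos (hM.pos j) (by positivity))).mono fun _ h => h.le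
  refine ⟨ε, hε0, fun a F hF E hE hvol hEε y hy => ?_⟩
  obtain ⟨x, hxE, hsep⟩ := exists_separated_points (E := E) ⟨a, fun z hz => (hE hz).1⟩ hg m' <| by
    refine lt_of_lt_of_le ((ENNReal.ofReal_lt_ofReal_iff hs).2 ?_) hvol
    have : (m' : ℝ) * (2 * g) = s * (m' / (2 * (m' + 1))) := by simp only [g]; field_simp; norm_num
    rw [this]
    refine mul_lt_of_lt_one_right hs ?_
    rw [div_lt_one (by positivity)]
    linarith [(Nat.cast_nonneg m' : (0 : ℝ) ≤ m')]
  -- Pigeonhole: the lengths of the K groups sum to at most 1.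
  obtain ⟨c, hcK, hc⟩ : ∃ c < K, x ((c + 1) * 2 ^ N) - x (c * 2 ^ N) ≤ 1 / K := by
    by_contra! hcon
    have : ∑ c ∈ Finset.range K, (1 / K : ℝ) <
        ∑ c ∈ Finset.range K, (x ((c + 1) * 2 ^ N) - x (c * 2 ^ N)) :=
      Finset.sum_lt_sum_of_nonempty ⟨0, by simpa using hK0⟩
        fun c hc => hcon c (Finset.mem_range.1 hc)
    rw [Finset.sum_range_sub (fun c => x (c * 2 ^ N))] at this
    have h1 := (hE (hxE (K * 2 ^ N) le_rfl)).2
    have h2 := (hE (hxE (0 * 2 ^ N) (by simp))).1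
    have h3 : ∑ c ∈ Finset.range K, (1 / K : ℝ) = 1 := by simp; field_simp
    linarith
  have hle : (c + 1) * 2 ^ N ≤ m' := Nat.mul_le_mul_right _ hcK
  have hN0 : 0 < 2 ^ N := by positivity
  have hcN : (c + 1) * 2 ^ N = c * 2 ^ N + 2 ^ N := by ring
  have hmono : ∀ i j, i ≤ j → j ≤ m' → x i ≤ x j := by
    intro i j hij
    induction j, hij using Nat.le_induction with
    | base => exact fun _ => le_rfl
    | succ j _ ih => intro h; linarith [ih (by omega), hsep j (by omega)]
  set u := x (c * 2 ^ N)
  set v := x ((c + 1) * 2 ^ N)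
  have huv : Set.Icc u v ⊆ Set.Icc a (a + 1) :=
    Set.Icc_subset_Icc (hE (hxE _ (by omega))).1 (hE (hxE _ hle)).2
  have hsmall : ∀ j, 2 ^ N * |F j u| ≤ 2 ^ j * M j := by
    intro j
    have hu : u ∈ Set.Icc u v := Set.left_mem_Icc.2 (hmono _ _ (by omega) hle)
    rcases lt_or_ge j N with hj | hj
    · have hp : 2 ^ j ≤ 2 ^ N := Nat.pow_le_pow_right (by norm_num) hj.le
      obtain ⟨ξ, hξ, h⟩ := exists_small_deriv_of_separated hF hg j 0 ε u v huv
        (fun i => x (c * 2 ^ N + i))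
        (fun i hi => ⟨hmono _ _ (by omega) (by omega), hmono _ _ (by omega) (by omega)⟩)
        (fun i hi => hEε _ (hxE _ (by omega)))
        (fun i hi => hsep _ (by omega))
      rw [zero_add] at h
      have hmv := (convex_Icc u v).norm_image_sub_le_of_norm_hasDerivWithin_le
        (fun w hw => (hF.hasDerivWithinAt j w (huv hw)).mono huv)
        (fun w hw => hF.bound (j + 1) w (huv hw)) hξ hu
      have hd : |u - ξ| ≤ 1 / K := by rw [abs_le]; constructor <;> linarith [hξ.1, hξ.2]
      have h1 : M (j + 1) * |u - ξ| ≤ M j / 2 ^ (N + 1) :=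
        (mul_le_mul_of_nonneg_left hd (hM.pos _).le).trans (hK j (Finset.mem_range.2 hj))
      have h2 := h.trans (hε j (Finset.mem_range.2 hj))
      rw [Real.norm_eq_abs, Real.norm_eq_abs] at hmv
      have h3 : |F j u| ≤ M j / 2 ^ N := by
        have : M j / 2 ^ N = M j / 2 ^ (N + 1) + M j / 2 ^ (N + 1) := by
          rw [pow_succ]; field_simp; norm_num
        linarith [abs_sub_abs_le_abs_sub (F j u) (F j ξ)]
      rw [le_div_iff₀ (by positivity)] at h3
      have h4 : (1 : ℝ) ≤ 2 ^ j := one_le_pow₀ one_le_two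
      nlinarith [hM.pos j]
    · exact mul_le_mul (pow_le_pow_right₀ one_le_two hj) (hF.bound _ _ (huv hu)) (abs_nonneg _)
        (by positivity)
  have huI : u ∈ Set.Icc a (a + 1) := hE (hxE _ (by omega))
  have hfin := hF.propagate hM k m huI hsmall hy
    ((abs_le.2 ⟨by linarith [hy.1, huI.2], by linarith [hy.2, huI.1]⟩).trans hm) 0
  rw [hM.zero, pow_zero, one_mul, mul_comm, ← le_div_iff₀ (by positivity)] at hfin
  refine hfin.trans_lt ?_
  rwa [one_div_pow] at hk

/-! ### Cubes and essential suprema -/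

section UnitCube

variable {d : ℕ} (a : Fin d → ℝ)

theorem unitCube_eq_pi : unitCube a = Set.univ.pi fun i => Set.Icc (a i) (a i + 1) :=
  (Set.pi_univ_Icc _ _).symm

theorem convex_unitCube : Convex ℝ (unitCube a) := convex_Icc _ _

theorem isCompact_unitCube : IsCompact (unitCube a) := isCompact_Icc

theorem left_mem_unitCube : a ∈ unitCube a := ⟨le_rfl, fun i => by simp⟩

theorem interior_unitCube_nonempty : (interior (unitCube a)).Nonempty := by
  rw [unitCube_eq_pi, interior_pi_set Set.finite_univ]
  exact ⟨fun i => a i + 1 / 2, fun i _ => by simp only [interior_Icc]; constructor <;> linarith⟩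

theorem uniqueDiffOn_unitCube : UniqueDiffOn ℝ (unitCube a) :=
  uniqueDiffOn_convex (convex_unitCube a) (interior_unitCube_nonempty a)

theorem unitCube_subset_closure_interior : unitCube a ⊆ closure (interior (unitCube a)) := by
  rw [(convex_unitCube a).closure_interior_eq_closure_of_nonempty_interior
    (interior_unitCube_nonempty a)]
  exact subset_closure

theorem volume_unitCube : volume (unitCube a) = 1 := by
  simp [unitCube, Real.volume_Icc_pi]

variable {a}

theorem cons_mem_unitCube {a : Fin (d + 1) → ℝ} {x : ℝ} {y : Fin d → ℝ} :
    (Fin.cons x y : Fin (d + 1) → ℝ) ∈ unitCube a ↔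
      x ∈ Set.Icc (a 0) (a 0 + 1) ∧ y ∈ unitCube (Fin.tail a) := by
  simp only [unitCube_eq_pi, Set.mem_univ_pi, Fin.forall_fin_succ, Fin.cons_zero, Fin.cons_succ]
  rfl

theorem mem_unitCube_one {a : Fin 1 → ℝ} {y : Fin 1 → ℝ} :
    y ∈ unitCube a ↔ y 0 ∈ Set.Icc (a 0) (a 0 + 1) := by
  simp only [unitCube_eq_pi, Set.mem_univ_pi, Fin.forall_fin_one]

/-- A continuous function on a cube is bounded pointwise by its essential supremum. -/
theorem enorm_le_eLpNorm_top_of_mem_unitCube {f : (Fin d → ℝ) → ℝ}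
    (hf : ContinuousOn f (unitCube a)) {x : Fin d → ℝ} (hx : x ∈ unitCube a) :
    ‖f x‖ₑ ≤ eLpNorm f ⊤ (volume.restrict (unitCube a)) := by
  set b := eLpNorm f ⊤ (volume.restrict (unitCube a)) with hb
  rcases eq_or_ne b ⊤ with h | h
  · simp [h]
  -- This continuous function is almost everywhere constant, hence constant on the cube, which lies
  -- in the closure of its interior.
  have hae : (fun y => max ‖f y‖ b.toReal) =ᵐ[volume.restrict (unitCube a)]
      fun _ => b.toReal := by
    have := ae_le_eLpNormEssSup (f := f) (μ := volume.restrict (unitCube a))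
    rw [← eLpNorm_exponent_top, ← hb] at this
    filter_upwards [this] with y hy
    refine max_eq_right ?_
    rw [← toReal_enorm]
    exact ENNReal.toReal_mono h hy
  have := Measure.eqOn_of_ae_eq hae (hf.norm.sup continuousOn_const) continuousOn_const
    (unitCube_subset_closure_interior a) hx
  have h2 : ‖f x‖ ≤ b.toReal := max_eq_right_iff.1 this
  rw [← ofReal_norm]
  exact ENNReal.ofReal_le_of_le_toReal h2

end UnitCube

theorem eLpNorm_top_restrict_le {d : ℕ} {f : (Fin d → ℝ) → ℝ} {S : Set (Fin d → ℝ)}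
    (hS : MeasurableSet S) {m : ℝ} (h : ∀ x ∈ S, |f x| ≤ m) :
    eLpNorm f ⊤ (volume.restrict S) ≤ ENNReal.ofReal m := by
  rw [eLpNorm_exponent_top]
  refine eLpNormEssSup_le_of_ae_bound ?_
  filter_upwards [ae_restrict_mem hS] with x hx
  exact h x hx

/-! ### Carleman classes and slices -/

namespace MemCarlemanClass

variable {M : ℕ → ℝ} {d : ℕ} {a : Fin d → ℝ} {f : (Fin d → ℝ) → ℝ}

theorem abs_le (hf : MemCarlemanClass M (unitCube a) f) {x : Fin d → ℝ} (hx : x ∈ unitCube a) :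
    |f x| ≤ M 0 := by
  simpa using hf.2 0 Fin.elim0 x hx

open scoped Pointwise in
/-- The Carleman classes are stable under restriction to coordinate slices of a cube. -/
theorem comp_affine (hf : MemCarlemanClass M (unitCube a) f) {k : ℕ}
    (L : (Fin k → ℝ) →L[ℝ] (Fin d → ℝ)) (c : Fin d → ℝ) (σ : Fin k → Fin d)
    (hL : ∀ i, L (Pi.single i 1) = Pi.single (σ i) 1) {a' : Fin k → ℝ}
    (hpre : ∀ y, L y + c ∈ unitCube a ↔ y ∈ unitCube a') :
    MemCarlemanClass M (unitCube a') fun y => f (L y + c) := by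
  -- The translation is split off so that the chain rule is needed only for the linear map `L`.
  set S : Set (Fin d → ℝ) := -c +ᵥ unitCube a
  have hS : c +ᵥ S = unitCube a := by simp [S]
  have hmem : ∀ z, z ∈ S ↔ z + c ∈ unitCube a := by
    intro z
    simp [S, Set.mem_vadd_set_iff_neg_vadd_mem, add_comm]
  have hg : ContDiffOn ℝ ((⊤ : ℕ∞) : WithTop ℕ∞) (fun z => f (z + c)) S :=
    hf.1.comp (by fun_prop) fun z hz => (hmem z).1 hz
  have hpre' : L ⁻¹' S = unitCube a' := by
    ext y
    rw [Set.mem_preimage, hmem, hpre]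
  have hSu : UniqueDiffOn ℝ S := by
    refine uniqueDiffOn_convex ((convex_unitCube a).vadd _) ?_
    rw [interior_vadd]
    exact (interior_unitCube_nonempty a).vadd_set
  refine ⟨?_, fun n j y hy => ?_⟩
  · have := hg.comp L.contDiff.contDiffOn (Set.Subset.refl (L ⁻¹' S))
    rwa [hpre'] at this
  · have hLy : L y ∈ S := (hmem _).2 ((hpre y).2 hy)
    have h := L.iteratedFDerivWithin_comp_right hg hSu
      (by rw [hpre']; exact uniqueDiffOn_unitCube a') hLy (i := n) (by exact_mod_cast le_top)
    rw [hpre'] at h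
    change |iteratedFDerivWithin ℝ n ((fun z => f (z + c)) ∘ L) (unitCube a') y _| ≤ M n
    rw [h, iteratedFDerivWithin_comp_add_right, hS,
      ContinuousMultilinearMap.compContinuousLinearMap_apply]
    simp only [hL]
    exact hf.2 n (σ ∘ j) _ ((hmem _).1 hLy)

theorem slice_fst {a : Fin (d + 1) → ℝ} {f : (Fin (d + 1) → ℝ) → ℝ}
    (hf : MemCarlemanClass M (unitCube a) f) {y : Fin d → ℝ} (hy : y ∈ unitCube (Fin.tail a)) :
    MemCarlemanClass M (unitCube fun _ : Fin 1 => a 0)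
      fun x => f (Fin.cons (x 0) y : Fin (d + 1) → ℝ) := by
  let L : (Fin 1 → ℝ) →L[ℝ] (Fin (d + 1) → ℝ) :=
    (ContinuousLinearMap.single ℝ (fun _ => ℝ) 0).comp (ContinuousLinearMap.proj 0)
  have hLc : ∀ x, L x + (Fin.cons 0 y : Fin (d + 1) → ℝ) = (Fin.cons (x 0) y : Fin (d + 1) → ℝ) := by
    intro x
    ext i
    refine Fin.cases ?_ (fun i => ?_) i <;> simp [L]
  have := hf.comp_affine (a' := fun _ => a 0) L (Fin.cons 0 y) (fun _ => 0) ?_ ?_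
  · simpa only [hLc] using this
  · intro i
    obtain rfl := Subsingleton.elim i 0
    simp [L]
  · intro x
    rw [hLc, cons_mem_unitCube, mem_unitCube_one]
    simp [hy]

theorem slice_snd {a : Fin (d + 1) → ℝ} {f : (Fin (d + 1) → ℝ) → ℝ}
    (hf : MemCarlemanClass M (unitCube a) f) {x : ℝ} (hx : x ∈ Set.Icc (a 0) (a 0 + 1)) :
    MemCarlemanClass M (unitCube (Fin.tail a)) fun y => f (Fin.cons x y : Fin (d + 1) → ℝ) := by
  let L : (Fin d → ℝ) →L[ℝ] (Fin (d + 1) → ℝ) :=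
    ContinuousLinearMap.pi (Fin.cons 0 fun i => ContinuousLinearMap.proj i)
  have hLc : ∀ y, L y + (Fin.cons x 0 : Fin (d + 1) → ℝ) = (Fin.cons x y : Fin (d + 1) → ℝ) := by
    intro y
    ext i
    refine Fin.cases ?_ (fun i => ?_) i <;> simp [L]
  have := hf.comp_affine (a' := Fin.tail a) L (Fin.cons x 0) Fin.succ ?_ ?_
  · simpa only [hLc] using this
  · intro i
    ext k
    refine Fin.cases ?_ (fun k => ?_) k
    · simp [L]
    · simp [L, Pi.single_apply]
  · intro y
    rw [hLc, cons_mem_unitCube]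
    exact and_iff_right hx

theorem const {c : ℝ} (hM : ∀ n, 0 < M n) (hc : |c| ≤ M 0) (Q : Set (Fin d → ℝ)) :
    MemCarlemanClass M Q fun _ => c := by
  refine ⟨contDiffOn_const, fun n j x _ => ?_⟩
  rcases n with _ | n
  · simpa using hc
  · simpa [iteratedFDerivWithin_succ_const] using (hM _).le

/-- The successive derivatives of a function of one variable in a Carleman class. -/
theorem isDerivChain {a : Fin 1 → ℝ} {f : (Fin 1 → ℝ) → ℝ}
    (hf : MemCarlemanClass M (unitCube a) f) :
    IsDerivChain M (fun n x => iteratedFDerivWithin ℝ n f (unitCube a) (fun _ => x)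
      fun _ => Pi.single 0 1) (a 0) (a 0 + 1) where
  bound n x hx := hf.2 n (fun _ => 0) _ (mem_unitCube_one.2 hx)
  hasDerivWithinAt n x hx := by
    have hx' : (fun _ => x) ∈ unitCube a := mem_unitCube_one.2 hx
    have h1 := (hf.1.differentiableOn_iteratedFDerivWithin (m := n)
      (by exact_mod_cast ENat.natCast_lt_top n) (uniqueDiffOn_unitCube a) _ hx').hasFDerivWithinAt
    have h2 : HasDerivWithinAt (fun (x : ℝ) (_ : Fin 1) => x) (Pi.single 0 1)
        (Set.Icc (a 0) (a 0 + 1)) x := by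
      rw [hasDerivWithinAt_pi]
      intro i
      obtain rfl := Subsingleton.elim i 0
      simpa using (hasDerivAt_id' x).hasDerivWithinAt
    have h3 := h1.comp_hasDerivWithinAt x h2 fun z hz => mem_unitCube_one.2 hz
    have h4 := (ContinuousMultilinearMap.apply ℝ (fun _ : Fin n => Fin 1 → ℝ) ℝ
      fun _ => Pi.single 0 1).hasFDerivAt.comp_hasDerivWithinAt x h3
    exact h4

end MemCarlemanClass

/-! ### Admissible constants and dimension one -/

namespace IsRemezConstant

variable {M : ℕ → ℝ} {d : ℕ} {t s : ℝ} {C : ℝ≥0}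

/-- Together with its converse `of_abs_le`, this replaces essential suprema by pointwise bounds,
which, unlike the former, restrict to slices. -/
theorem abs_le (hC : IsRemezConstant M d t s C) {a : Fin d → ℝ} {f : (Fin d → ℝ) → ℝ}
    {E : Set (Fin d → ℝ)} (hf : MemCarlemanClass M (unitCube a) f) (hE : MeasurableSet E)
    (hEQ : E ⊆ unitCube a) (hs : ENNReal.ofReal s ≤ volume E) {m : ℝ} (hm0 : 0 ≤ m)
    (hm : ∀ x ∈ E, |f x| ≤ m) {x : Fin d → ℝ} (hx : x ∈ unitCube a) (ht : t ≤ |f x|) :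
    |f x| ≤ C * m := by
  have hxle := enorm_le_eLpNorm_top_of_mem_unitCube hf.1.continuousOn hx
  rw [Real.enorm_eq_ofReal_abs] at hxle
  have h := hC a f E hf ((ENNReal.ofReal_le_ofReal ht).trans hxle) hE hEQ hs
  have h2 : ENNReal.ofReal |f x| ≤ ENNReal.ofReal (C * m) := by
    rw [ENNReal.ofReal_mul C.coe_nonneg, ENNReal.ofReal_coe_nnreal]
    exact hxle.trans (h.trans (mul_le_mul_right (eLpNorm_top_restrict_le hE hm) _))
  exact (ENNReal.ofReal_le_ofReal_iff (by positivity)).1 h2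

theorem of_abs_le (h : ∀ (a : Fin d → ℝ) (f : (Fin d → ℝ) → ℝ) (E : Set (Fin d → ℝ)),
    MemCarlemanClass M (unitCube a) f → MeasurableSet E → E ⊆ unitCube a →
    ENNReal.ofReal s ≤ volume E → ∀ m : ℝ, 0 ≤ m → (∀ x ∈ E, |f x| ≤ m) →
    ∀ x ∈ unitCube a, t ≤ |f x| → |f x| ≤ C * m) : IsRemezConstant M d t s C := by
  intro a f E hf ht hE hEQ hs
  obtain ⟨x, hx, hmax⟩ := (isCompact_unitCube a).exists_isMaxOn ⟨a, left_mem_unitCube a⟩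
    hf.1.continuousOn.norm
  have hle : eLpNorm f ⊤ (volume.restrict (unitCube a)) ≤ ENNReal.ofReal |f x| :=
    eLpNorm_top_restrict_le (isCompact_unitCube a).measurableSet fun y hy => hmax hy
  have htx : t ≤ |f x| := (ENNReal.ofReal_le_ofReal_iff (abs_nonneg _)).1 (ht.trans hle)
  set b := eLpNorm f ⊤ (volume.restrict E) with hb
  have hb_top : b ≠ ⊤ := by
    refine ne_top_of_le_ne_top ENNReal.ofReal_ne_top
      (eLpNorm_top_restrict_le hE (m := |f x|) fun y hy => hmax (hEQ hy))
  have hcl : IsClosed (unitCube a ∩ (fun y => |f y|) ⁻¹' Set.Iic b.toReal) :=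
    hf.1.continuousOn.norm.preimage_isClosed_of_isClosed (isCompact_unitCube a).isClosed
      isClosed_Iic
  -- Removing a null set from E makes the almost everywhere bound pointwise.
  set E₀ := E ∩ (unitCube a ∩ (fun y => |f y|) ⁻¹' Set.Iic b.toReal)
  have hvol : volume E₀ = volume E := by
    refine measure_congr ?_
    have hae := ae_le_eLpNormEssSup (f := f) (μ := volume.restrict E)
    rw [← eLpNorm_exponent_top, ← hb, ae_restrict_iff' hE] at hae
    filter_upwards [hae] with y hy
    refine propext ⟨fun h => h.1, fun h => ⟨h, hEQ h, ?_⟩⟩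
    change |f y| ≤ b.toReal
    rw [← Real.norm_eq_abs, ← toReal_enorm]
    exact ENNReal.toReal_mono hb_top (hy h)
  have key := h a f E₀ hf (hE.inter hcl.measurableSet) (Set.inter_subset_left.trans hEQ)
    (hs.trans hvol.ge) b.toReal ENNReal.toReal_nonneg (fun y hy => hy.2.2) x hx htx
  refine hle.trans ((ENNReal.ofReal_le_ofReal key).trans ?_)
  rw [ENNReal.ofReal_mul C.coe_nonneg, ENNReal.ofReal_coe_nnreal, ENNReal.ofReal_toReal hb_top]

/-- Test with the constant function 1 and E the whole cube. -/
theorem one_le (hC : IsRemezConstant M d t s C) (hM : IsQuasianalyticSeq M) (ht : t ≤ 1)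
    (hs : s ≤ 1) : 1 ≤ C := by
  have := hC.abs_le (a := 0) (MemCarlemanClass.const hM.pos (c := 1) (by simp [hM.zero]) _)
    (isCompact_unitCube 0).measurableSet subset_rfl
    (by rw [volume_unitCube]; simpa using hs) zero_le_one (by simp)
    (left_mem_unitCube 0) (by simpa using ht)
  simpa using this

/-- The admissible constants have a least element as soon as there are any. -/
theorem isLeast_sInf (h : ∃ C, IsRemezConstant M d t s C) :
    IsLeast {C : ℝ≥0 | IsRemezConstant M d t s C} (sInf {C : ℝ≥0 | IsRemezConstant M d t s C}) := by
  refine ⟨of_abs_le fun a f E hf hE hEQ hs m hm0 hm x hx ht => ?_, fun C hC => csInf_le' hC⟩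
  -- For m > 0, |f x| / m is a lower bound of the admissible constants; for m = 0 a single one
  -- forces f x = 0.
  rcases hm0.eq_or_lt with rfl | hm_pos
  · obtain ⟨C, hC⟩ := h
    simpa using hC.abs_le hf hE hEQ hs le_rfl hm hx ht
  · have hle : (|f x| / m).toNNReal ≤ sInf {C : ℝ≥0 | IsRemezConstant M d t s C} :=
      le_csInf h fun C hC => Real.toNNReal_le_iff_le_coe.2 <|
        (div_le_iff₀ hm_pos).2 (hC.abs_le hf hE hEQ hs hm0 hm hx ht)
    exact (div_le_iff₀ hm_pos).1 (Real.toNNReal_le_iff_le_coe.1 hle)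

theorem exists_one (hM : IsQuasianalyticSeq M) (ht : 0 < t) (hs : 0 < s) :
    ∃ C, IsRemezConstant M 1 t s C := by
  obtain ⟨ε, hε, h⟩ := exists_smallness_threshold hM ht hs
  -- If m ≤ ε then |f| < t everywhere, a contradiction; otherwise |f x| ≤ 1 ≤ m / ε.
  refine ⟨⟨1 / ε, by positivity⟩, of_abs_le fun a f E hf hE hEQ hs m hm0 hm x hx htx => ?_⟩
  have hvp := (volume_preserving_funUnique (Fin 1) ℝ).symm
  have hmε : ε < m := by
    by_contra! hcon
    have := h (a 0) _ hf.isDerivChain ((fun (x : ℝ) (_ : Fin 1) => x) ⁻¹' E)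
      (fun z hz => mem_unitCube_one.1 (hEQ hz))
      (hs.trans (hvp.measure_preimage hE.nullMeasurableSet).ge)
      (fun z hz => (by simpa using (hm _ hz).trans hcon)) (x 0) (mem_unitCube_one.1 hx)
    simp only [iteratedFDerivWithin_zero_apply] at this
    rw [show (fun _ => x 0) = x from funext fun i => by rw [Subsingleton.elim i 0]] at this
    linarith
  calc |f x| ≤ 1 := hM.zero ▸ hf.abs_le hx
    _ ≤ 1 / ε * m := by rw [one_div_mul_eq_div, one_le_div hε]; exact hmε.le

end IsRemezConstant

/-! ### Fubini and large slices -/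

section Slices

variable {d : ℕ} {E : Set (Fin (d + 1) → ℝ)}

theorem measurable_fin_cons (x : ℝ) :
    Measurable fun y : Fin d → ℝ => (Fin.cons x y : Fin (d + 1) → ℝ) := by
  refine measurable_pi_iff.2 fun i => ?_
  refine Fin.cases ?_ (fun i => ?_) i
  · exact measurable_const
  · exact measurable_pi_apply i

theorem piFinSuccAbove_zero_symm_apply (x : ℝ) (y : Fin d → ℝ) :
    (MeasurableEquiv.piFinSuccAbove (fun _ : Fin (d + 1) => ℝ) 0).symm (x, y) = Fin.cons x y :=
  Fin.insertNth_zero' x y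

theorem volume_eq_lintegral_slices (hE : MeasurableSet E) :
    volume E = ∫⁻ x : ℝ, volume {y : Fin d → ℝ | (Fin.cons x y : Fin (d + 1) → ℝ) ∈ E} := by
  have h := (volume_preserving_piFinSuccAbove (fun _ : Fin (d + 1) => ℝ) 0).symm
  rw [← h.measure_preimage hE.nullMeasurableSet, Measure.volume_eq_prod,
    Measure.prod_apply (h.measurable hE)]
  simp only [← piFinSuccAbove_zero_symm_apply]
  rfl

theorem measurable_volume_slice (hE : MeasurableSet E) :
    Measurable fun x : ℝ => volume {y : Fin d → ℝ | (Fin.cons x y : Fin (d + 1) → ℝ) ∈ E} := by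
  have h := (volume_preserving_piFinSuccAbove (fun _ : Fin (d + 1) => ℝ) 0).symm
  simp only [← piFinSuccAbove_zero_symm_apply]
  exact measurable_measure_prodMk_left (ν := (volume : Measure (Fin d → ℝ))) (h.measurable hE)

/-- If a subset of the unit cube has measure at least `s`, then the slices of measure at least
`s / 2` form a set of measure larger than `s / 2`. -/
theorem half_lt_volume_large_slices {a : Fin (d + 1) → ℝ} (hE : MeasurableSet E)
    (hEQ : E ⊆ unitCube a) {s : ℝ} (hs0 : 0 < s) (hs1 : s ≤ 1) (hs : ENNReal.ofReal s ≤ volume E) :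
    ENNReal.ofReal (s / 2) < volume {x : ℝ | ENNReal.ofReal (s / 2) ≤
      volume {y : Fin d → ℝ | (Fin.cons x y : Fin (d + 1) → ℝ) ∈ E}} := by
  set A : Set ℝ := {x : ℝ | ENNReal.ofReal (s / 2) ≤
      volume {y : Fin d → ℝ | (Fin.cons x y : Fin (d + 1) → ℝ) ∈ E}}
  have hA : MeasurableSet A := measurable_volume_slice hE measurableSet_Ici
  by_contra! hcon
  -- If A had measure at most s / 2, integration would give s ≤ s / 2 + (1 - s / 2) (s / 2) = s - s²
  -- / 4.
  have hle : ∀ x : ℝ, volume {y : Fin d → ℝ | (Fin.cons x y : Fin (d + 1) → ℝ) ∈ E} ≤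
      (Set.Icc (a 0) (a 0 + 1)).indicator (fun _ => ENNReal.ofReal (s / 2)) x +
        A.indicator (fun _ => ENNReal.ofReal (1 - s / 2)) x := by
    intro x
    by_cases hx : x ∈ Set.Icc (a 0) (a 0 + 1)
    · rw [Set.indicator_of_mem hx]
      by_cases hxA : x ∈ A
      · rw [Set.indicator_of_mem hxA, ← ENNReal.ofReal_add (by linarith) (by linarith),
          add_sub_cancel, ENNReal.ofReal_one, ← volume_unitCube (Fin.tail a)]
        exact measure_mono fun y hy => (cons_mem_unitCube.1 (hEQ hy)).2
      · exact (not_le.1 hxA).le.trans le_self_add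
    · have : {y : Fin d → ℝ | (Fin.cons x y : Fin (d + 1) → ℝ) ∈ E} = ∅ :=
        Set.eq_empty_of_forall_notMem fun y hy => hx (cons_mem_unitCube.1 (hEQ hy)).1
      simp [this]
  have h1 := hs.trans_eq (volume_eq_lintegral_slices hE) |>.trans (lintegral_mono hle)
  rw [lintegral_add_left (measurable_const.indicator measurableSet_Icc),
    lintegral_indicator_const measurableSet_Icc, lintegral_indicator_const hA, Real.volume_Icc,
    add_sub_cancel_left, ENNReal.ofReal_one, mul_one] at h1
  have h2 := h1.trans (add_le_add_right (mul_le_mul_right hcon _) _)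
  rw [← ENNReal.ofReal_mul (by linarith), ← ENNReal.ofReal_add (by linarith) (by nlinarith),
    ENNReal.ofReal_le_ofReal_iff (by nlinarith)] at h2
  nlinarith

end Slices

/-! ### Recursion in the dimension -/

namespace IsRemezConstant

variable {M : ℕ → ℝ} {d : ℕ} {t s : ℝ} {C₁ C₂ : ℝ≥0}

/-- A Remez inequality in dimension one, applied to a function `g` and to a set of measure larger
than `s`, is attained without loss at a point of that set. -/
theorem exists_le_of_lt_volume (h : IsRemezConstant M 1 t s C₁) (hC : 0 < C₁)
    {a : ℝ} {g : (Fin 1 → ℝ) → ℝ}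
    (hg : MemCarlemanClass M (unitCube fun _ => a) g) {A : Set ℝ} (hA : MeasurableSet A)
    (hAI : A ⊆ Set.Icc a (a + 1)) (hs : ENNReal.ofReal s < volume A) {x : Fin 1 → ℝ}
    (hx : x ∈ unitCube fun _ => a) (ht : t ≤ |g x|) :
    ∃ z ∈ A, |g x| / C₁ ≤ |g fun _ => z| := by
  by_contra! hcon
  set c := |g x| / C₁
  have hcx : |g x| = C₁ * c := by simp only [c]; field_simp
  -- The B k increase to A, so some B k still has measure above s; the inequality on it gives c ≤ c
  -- - 1 / (k + 1).
  let B : ℕ → Set ℝ := fun k => {z | z ∈ A ∧ |g fun _ => z| ≤ c - 1 / (k + 1)}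
  have hBmono : Monotone B := fun k l hkl z hz => ⟨hz.1, hz.2.trans (by gcongr)⟩
  have hBU : ⋃ k, B k = A := by
    refine Set.Subset.antisymm (Set.iUnion_subset fun k z hz => hz.1) fun z hz => ?_
    obtain ⟨k, hk⟩ := exists_nat_one_div_lt (sub_pos.2 (hcon z hz))
    exact Set.mem_iUnion.2 ⟨k, hz, by linarith⟩
  have hlim := tendsto_measure_iUnion_atTop (μ := volume) hBmono
  rw [hBU] at hlim
  obtain ⟨k, hk⟩ := (hlim.eventually (lt_mem_nhds hs)).exists
  simp only [Function.comp_apply] at hk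
  obtain ⟨z, hz⟩ : (B k).Nonempty := nonempty_of_measure_ne_zero (ne_of_gt (bot_le.trans_lt hk))
  have hvp := volume_preserving_funUnique (Fin 1) ℝ
  have hcont : ContinuousOn (fun z : ℝ => |g fun _ => z|) (Set.Icc a (a + 1)) :=
    (hg.1.continuousOn.comp (by fun_prop) fun z hz => mem_unitCube_one.2 hz).norm
  have hBm : MeasurableSet (B k) := by
    have : B k = A ∩ (Set.Icc a (a + 1) ∩ (fun z : ℝ => |g fun _ => z|) ⁻¹'
        Set.Iic (c - 1 / (k + 1))) := by
      ext z
      exact ⟨fun hz => ⟨hz.1, hAI hz.1, hz.2⟩, fun hz => ⟨hz.1, hz.2.2⟩⟩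
    rw [this]
    exact hA.inter (hcont.preimage_isClosed_of_isClosed isClosed_Icc isClosed_Iic).measurableSet
  have key := h.abs_le hg (hvp.measurable hBm)
    (fun y hy => mem_unitCube_one.2 (hAI hy.1))
    (hk.le.trans (hvp.measure_preimage hBm.nullMeasurableSet).ge)
    ((abs_nonneg _).trans hz.2)
    (fun y hy => by
      have : (fun _ => y 0) = y := funext fun i => by rw [Subsingleton.elim i 0]
      exact this ▸ hy.2) hx ht
  rw [hcx] at key
  have h1 := le_of_mul_le_mul_left key (NNReal.coe_pos.2 hC)
  have h2 : (0 : ℝ) < 1 / (k + 1) := by positivity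
  linarith

/-- The recursion in the dimension. -/
theorem succ (h₁ : IsRemezConstant M 1 t (s / 2) C₁)
    (h₂ : IsRemezConstant M d (t / C₁) (s / 2) C₂) (hC₁ : 0 < C₁) (hs0 : 0 < s) (hs1 : s ≤ 1) :
    IsRemezConstant M (d + 1) t s (C₁ * C₂) := by
  refine of_abs_le fun a f E hf hE hEQ hs m hm0 hm x hx htx => ?_
  have hC₁' : (0 : ℝ) < C₁ := NNReal.coe_pos.2 hC₁
  obtain ⟨p, y, rfl⟩ : ∃ p y, x = (Fin.cons p y : Fin (d + 1) → ℝ) :=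
    ⟨x 0, Fin.tail x, (Fin.cons_self_tail x).symm⟩
  obtain ⟨hp, hy⟩ := cons_mem_unitCube.1 hx
  set A : Set ℝ := {x : ℝ | ENNReal.ofReal (s / 2) ≤
      volume {y : Fin d → ℝ | (Fin.cons x y : Fin (d + 1) → ℝ) ∈ E}}
  have hA : MeasurableSet A := measurable_volume_slice hE measurableSet_Ici
  have hAI : A ⊆ Set.Icc (a 0) (a 0 + 1) := by
    intro z hz
    obtain ⟨w, hw⟩ := nonempty_of_measure_ne_zero
      (ne_of_gt ((ENNReal.ofReal_pos.2 (half_pos hs0)).trans_le hz))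
    exact (cons_mem_unitCube.1 (hEQ hw)).1
  obtain ⟨z, hzA, hz⟩ := h₁.exists_le_of_lt_volume hC₁ (hf.slice_fst hy) hA hAI
    (half_lt_volume_large_slices hE hEQ hs0 hs1 hs) (x := fun _ => p) (mem_unitCube_one.2 hp) htx
  -- On the slice at z the value at y is at least t / C₁, whence the lowered threshold.
  have key := h₂.abs_le (hf.slice_snd (hAI hzA)) (measurable_fin_cons z hE)
    (fun w hw => (cons_mem_unitCube.1 (hEQ hw)).2) hzA hm0 (fun w hw => hm _ hw) hy
    ((div_le_div_of_nonneg_right htx hC₁'.le).trans hz)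
  have h3 := (div_le_iff₀ hC₁').1 (hz.trans key)
  push_cast
  linarith

/-- The recursion runs with any admissible constants; 1 ≤ C₁ keeps t / C₁ in (0, 1]. -/
theorem exists_of_pos (hM : IsQuasianalyticSeq M) (hd : 1 ≤ d) (ht0 : 0 < t) (ht1 : t ≤ 1)
    (hs0 : 0 < s) (hs1 : s ≤ 1) : ∃ C, IsRemezConstant M d t s C := by
  induction d, hd using Nat.le_induction generalizing t s with
  | base => exact exists_one hM ht0 hs0
  | succ d _ ih =>
    obtain ⟨C₁, h₁⟩ := exists_one hM ht0 (half_pos hs0)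
    have hC₁ : 1 ≤ C₁ := h₁.one_le hM ht1 (by linarith)
    have hC₁' : (1 : ℝ) ≤ C₁ := by exact_mod_cast hC₁
    obtain ⟨C₂, h₂⟩ := ih (t := t / C₁) (s := s / 2) (by positivity)
      ((div_le_self ht0.le hC₁').trans ht1) (half_pos hs0) (by linarith)
    exact ⟨_, h₁.succ h₂ (by positivity) hs0 hs1⟩

end IsRemezConstant

/-- For a quasianalytic sequence `M`, the best constants `Θ d t s` in the Remez-type inequality are
finite, and they satisfy the recursive bound in the dimension `d`. -/
theorem proposition2p6 (M : ℕ → ℝ) (hM : IsQuasianalyticSeq M) :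
    ∃ Θ : ℕ → ℝ → ℝ → ℝ≥0,
      (∀ (d : ℕ) (t s : ℝ), 1 ≤ d → 0 < t → t ≤ 1 → 0 < s → s ≤ 1 →
        IsLeast {C : ℝ≥0 | IsRemezConstant M d t s C} (Θ d t s)) ∧
      (∀ (d : ℕ) (t s : ℝ), 2 ≤ d → 0 < t → t ≤ 1 → 0 < s → s ≤ 1 →
        1 ≤ Θ 1 t (s / 2) ∧
        Θ d t s ≤ Θ 1 t (s / 2) * Θ (d - 1) (t / (Θ 1 t (s / 2) : ℝ)) (s / 2)) := by
  have hleast : ∀ (d : ℕ) (t s : ℝ), 1 ≤ d → 0 < t → t ≤ 1 → 0 < s → s ≤ 1 →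
      IsLeast {C : ℝ≥0 | IsRemezConstant M d t s C}
        (sInf {C : ℝ≥0 | IsRemezConstant M d t s C}) := fun d t s hd ht0 ht1 hs0 hs1 =>
    IsRemezConstant.isLeast_sInf (IsRemezConstant.exists_of_pos hM hd ht0 ht1 hs0 hs1)
  refine ⟨fun d t s => sInf {C : ℝ≥0 | IsRemezConstant M d t s C}, hleast,
    fun d t s hd ht0 ht1 hs0 hs1 => ?_⟩
  obtain ⟨d, rfl⟩ : ∃ k, d = k + 1 := ⟨d - 1, by omega⟩
  have h₁ := (hleast 1 t (s / 2) le_rfl ht0 ht1 (half_pos hs0) (by linarith)).1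
  set C₁ := sInf {C : ℝ≥0 | IsRemezConstant M 1 t (s / 2) C}
  have hC₁ : 1 ≤ C₁ := h₁.one_le hM ht1 (by linarith)
  have hC₁' : (1 : ℝ) ≤ C₁ := by exact_mod_cast hC₁
  have h₂ := (hleast d (t / C₁) (s / 2) (by omega) (by positivity)
    ((div_le_self ht0.le hC₁').trans ht1) (half_pos hs0) (by linarith)).1
  exact ⟨hC₁, (hleast (d + 1) t s (by omega) ht0 ht1 hs0 hs1).2
    (h₁.succ h₂ (by positivity) hs0 hs1)⟩
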